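/- For finite graphs $F_1,\dots,F_r$, write $G\to(F_1,\dots,F_r)$ if for every colouring of the edges of $G$ with colours $1,\dots,r$ there is some $i$ such that the edges of colour $i$ contain a (not necessarily induced) copy of $F_i$. Let $\hat r(F_1,\dots,F_r)$ be the minimum number of edges of a finite graph $G$ with $G\to(F_1,\dots,F_r)$. Let $K_{m,n}$ denote the complete bipartite graph with parts of sizes $m$ and $n$. Theorem. Let $r\ge 2$ and let $s,s_3,\dots,s_r,t_3,\dots,t_r$ be positive integers with $t_i\ge s_i$ for $3\le i\le r$. Put $$\sigma=2s-r+\sum_{i=3}^r s_i,\qquad a'=a-\sum_{i=3}^r(s_i-1),\qquad f(a)=\frac{2\binom{a}{s}}{\binom{\lfloor a'/2\rfloor}{s}+\binom{\lceil a'/2\rceil}{s}}$$ for integers $a>\sigma$. Then the minimum $\min\{a\,f(a) : a\in\mathbb N,\ a>\sigma\}$ is attained, and there is a constant $C$, depending only on $r,s,s_3,\dots,s_r,t_3,\dots,t_r$, such that for every integer $n\ge 1$ the number $\hat r(K_{s,n},K_{s,n},K_{s_3,t_3},\dots,K_{s_r,t_r})$ is well defined (some finite graph has the arrowing property) and $$\Bigl|\hat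 r(K_{s,n},K_{s,n},K_{s_3,t_3},\dots,K_{s_r,t_r})-n\cdot\min\{a\,f(a) : a\in\mathbb N,\ a>\sigma\}\Bigr|\le C .$$ The case $r=2$ (no $s_i,t_i$, so $\sigma=2s-2$ and $a'=a$) gives the asymptotics of $\hat r(K_{s,n},K_{s,n})$ for fixed $s$. -/

import Mathlib

/-- The arrowing property `G → (F i)_{i : ι}`: for every colouring of the edges of `G` with colour
set `ι`, there is a colour `i` such that the graph formed by the edges of colour `i` contains a
(not necessarily induced) copy of `F i`. -/
def Arrows {V ι : Type} {W : ι → Type} (G : SimpleGraph V) (F : (i : ι) → SimpleGraph (W i)) :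
    Prop :=
  ∀ c : G.EdgeLabeling ι, ∃ i : ι, (F i).IsContained (c.labelGraph i)

/-- The set of all numbers of edges `e(G)`, where `G` is a finite graph that arrows `F`. -/
def arrowingSizes {ι : Type} {W : ι → Type} (F : (i : ι) → SimpleGraph (W i)) : Set ℕ :=
  {e | ∃ (N : ℕ) (G : SimpleGraph (Fin N)), Arrows G F ∧ G.edgeSet.ncard = e}

/-- The size Ramsey number: the smallest number of edges of a finite graph that arrows `F`. -/
noncomputable def sizeRamsey {ι : Type} {W : ι → Type} (F : (i : ι) → SimpleGraph (W i)) : ℕ :=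
  sInf (arrowingSizes F)

/-- The tuple of complete bipartite graphs `K_{a i, b i}`. -/
def completeBipartiteTuple {r : ℕ} (a b : Fin r → ℕ) (i : Fin r) :
    SimpleGraph (Fin (a i) ⊕ Fin (b i)) :=
  completeBipartiteGraph (Fin (a i)) (Fin (b i))

/-- The `r`-tuple `(K_{s,n}, K_{s,n}, K_{s₃,t₃}, …, K_{s_r,t_r})`, where `r = k + 2` and `S`, `T`
list `s₃, …, s_r` and `t₃, …, t_r`. -/
def forbiddenTuple {k : ℕ} (s : ℕ) (S T : Fin k → ℕ) (n : ℕ) (i : Fin (k + 2)) :=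
  completeBipartiteTuple (Matrix.vecCons s (Matrix.vecCons s S))
    (Matrix.vecCons n (Matrix.vecCons n T)) i

/-- `σ = 2s - r + ∑_{i=3}^r s_i`, where `r = k + 2`. -/
def sigma {k : ℕ} (s : ℕ) (S : Fin k → ℕ) : ℤ :=
  2 * (s : ℤ) - ((k + 2 : ℕ) : ℤ) + ∑ i, (S i : ℤ)

/-- `a' = a - ∑_{i=3}^r (s_i - 1)`. For `s, s_i ≥ 1` and `a > σ` no subtraction here truncates. -/
def aPrime {k : ℕ} (S : Fin k → ℕ) (a : ℕ) : ℕ :=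
  a - ∑ i, (S i - 1)

/-- `f(a) = 2 C(a, s) / (C(⌊a'/2⌋, s) + C(⌈a'/2⌉, s))`. -/
noncomputable def fRatio {k : ℕ} (s : ℕ) (S : Fin k → ℕ) (a : ℕ) : ℝ :=
  2 * (a.choose s : ℝ) /
    (((aPrime S a / 2).choose s : ℝ) + (((aPrime S a + 1) / 2).choose s : ℝ))

/-! Write g(a) for the denominator of f(a) and m for the minimum of a·f(a). Upper bound: K_{a,N}
with N ≈ n·f(a) arrows the tuple. Only boundedly many vertices on the N side can have s_i edges of a
later colour i. Every other vertex keeps a' edges in the first two colours, hence by convexity of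
binomials sees at least g(a) monochromatic s-sets. Pigeonhole over the 2·C(a,s) pairs (s-set,
colour) yields K_{s,n} (`arrows_completeBipartiteGraph`). Lower bound: if G has fewer than nm - C
edges, the set L of vertices of degree at least n has size at most 2m, and it contains the s-side of
any K_{s,n}. Group the vertices outside L by their neighbourhood A in L, and spread each group
evenly over all balanced colourings of A. An s-set in A then lies in a given one of the first two
colours for a fraction of about 1/f(|A|) ≤ |A|/m of the group (`exists_balanced_colouring`). Summing
|A| over all groups gives at most e(G), so every s-set has at most e(G)/m + O(1) < n common
neighbours in that colour (`exists_colouring_between`, `not_arrows_forbiddenTuple`). -/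

/-! ### Convexity of binomial coefficients. -/

/-- The least value of `C(x, s) + C(y, s)` under the constraint `x + y ≥ n`. -/
def balancedChoose (s n : ℕ) : ℕ :=
  (n / 2).choose s + ((n + 1) / 2).choose s

/-- Discrete convexity: by Pascal's rule the increments of C(·, s+1) are C(·, s), which is monotone.
-/
theorem choose_succ_add_choose_le {x y : ℕ} (s : ℕ) (h : x ≤ y) :
    (x + 1).choose s + y.choose s ≤ x.choose s + (y + 1).choose s := by
  cases s with
  | zero => simp
  | succ s =>
    have := Nat.choose_le_choose s h
    rw [Nat.choose_succ_succ', Nat.choose_succ_succ']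
    omega

/-- Moving one unit from the larger part to the smaller reduces the gap d by two and does not
increase the sum, hence the two-step induction. -/
theorem balancedChoose_le_aux (s d x : ℕ) :
    balancedChoose s (2 * x + d) ≤ x.choose s + (x + d).choose s := by
  induction d using Nat.twoStepInduction generalizing x with
  | zero => simp [balancedChoose, show (2 * x + 1) / 2 = x by omega]
  | one =>
    simp [balancedChoose, show (2 * x + 1) / 2 = x by omega,
      show (2 * x + 1 + 1) / 2 = x + 1 by omega]
  | more d ih _ =>
    have h := ih (x + 1)
    have h' := choose_succ_add_choose_le s (show x ≤ x + d + 1 by omega)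
    rw [show 2 * (x + 1) + d = 2 * x + (d + 2) by omega,
      show x + 1 + d = x + d + 1 by omega] at h
    rw [show x + (d + 2) = x + d + 1 + 1 by omega]
    omega

theorem balancedChoose_mono (s : ℕ) {m n : ℕ} (h : m ≤ n) :
    balancedChoose s m ≤ balancedChoose s n :=
  add_le_add (Nat.choose_le_choose s (by omega)) (Nat.choose_le_choose s (by omega))

theorem balancedChoose_le (s : ℕ) {n x y : ℕ} (h : n ≤ x + y) :
    balancedChoose s n ≤ x.choose s + y.choose s := by
  refine (balancedChoose_mono s h).trans ?_
  rcases le_total x y with hxy | hxy <;> obtain ⟨d, rfl⟩ := Nat.exists_eq_add_of_le hxy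
  · rw [← add_assoc, ← two_mul]
    exact balancedChoose_le_aux s d x
  · rw [add_right_comm, ← two_mul, add_comm (Nat.choose _ _)]
    exact balancedChoose_le_aux s d y

/-! ### Even distributions and averaging over permutations. -/

/-- A finite set can be partitioned into classes with prescribed capacities. -/
theorem exists_map_card_fiber_le {α ι : Type*} [Fintype α] [Fintype ι] [DecidableEq ι]
    (q : ι → ℕ) (h : Fintype.card α ≤ ∑ i, q i) :
    ∃ p : α → ι, ∀ i, (Finset.univ.filter fun v => p v = i).card ≤ q i := by
  classical
  obtain ⟨e⟩ : Nonempty (α ↪ Σ i, Fin (q i)) :=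
    Function.Embedding.nonempty_of_card_le (by simpa using h)
  refine ⟨fun v => (e v).1, fun i => ?_⟩
  have : (Finset.univ.filter fun v => (e v).1 = i).map e ⊆
      (Finset.univ : Finset (Fin (q i))).map (Function.Embedding.sigmaMk i) := by
    intro z hz
    simp only [Finset.mem_map, Finset.mem_filter, Finset.mem_univ, true_and] at hz ⊢
    obtain ⟨v, hv, rfl⟩ := hz
    subst hv
    exact ⟨(e v).2, rfl⟩
  simpa using Finset.card_le_card this

/-- A finite set can be mapped to a nonempty type with almost equal fibres. -/
theorem exists_equidistributed_map {V Ω : Type*} [Fintype Ω] [Nonempty Ω] [DecidableEq Ω]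
    (B : Finset V) :
    ∃ φ : V → Ω, ∀ ω, (B.filter fun b => φ b = ω).card * Fintype.card Ω ≤
      B.card + Fintype.card Ω := by
  classical
  set M := Fintype.card Ω with hM
  have hM0 : 0 < M := Fintype.card_pos
  let e : Ω ≃ Fin M := Fintype.equivFin Ω
  let idx : V → ℕ := fun b => if h : b ∈ B then (B.equivFin ⟨b, h⟩ : ℕ) else 0
  have idx_inj : Set.InjOn idx B := by
    intro b hb b' hb' h
    have hb : b ∈ B := hb
    have hb' : b' ∈ B := hb'
    simp only [idx, dif_pos hb, dif_pos hb'] at h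
    simpa using B.equivFin.injective (Fin.ext h)
  have idx_lt : ∀ b ∈ B, idx b < B.card := by
    intro b hb
    simp only [idx, dif_pos hb]
    exact Fin.is_lt _
  -- Enumerate `B` and deal its elements out cyclically; within a residue class the quotient
  -- determines the element.
  refine ⟨fun b => e.symm ⟨idx b % M, Nat.mod_lt _ hM0⟩, fun ω => ?_⟩
  have key : (B.filter fun b => e.symm ⟨idx b % M, Nat.mod_lt _ hM0⟩ = ω).card ≤
      B.card / M + 1 := by
    rw [← Finset.card_range (B.card / M + 1)]
    refine Finset.card_le_card_of_injOn (fun b => idx b / M) ?_ ?_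
    · intro b hb
      have hb := (Finset.mem_filter.1 (Finset.mem_coe.1 hb)).1
      simp only [Finset.coe_range, Set.mem_Iio]
      exact Nat.lt_succ_of_le (Nat.div_le_div_right (idx_lt b hb).le)
    · intro b hb b' hb' h
      obtain ⟨hb, h1⟩ := Finset.mem_filter.1 (Finset.mem_coe.1 hb)
      obtain ⟨hb', h2⟩ := Finset.mem_filter.1 (Finset.mem_coe.1 hb')
      apply idx_inj hb hb'
      have h3 : idx b % M = idx b' % M := by
        have := e.symm.injective (h1.trans h2.symm)
        simpa using congrArg Fin.val this
      have h : idx b / M = idx b' / M := h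
      rw [← Nat.div_add_mod (idx b) M, ← Nat.div_add_mod (idx b') M, h, h3]
  calc _ ≤ (B.card / M + 1) * M := Nat.mul_le_mul_right _ key
    _ ≤ B.card + M := by
      rw [add_mul, one_mul]
      exact Nat.add_le_add_right (Nat.div_mul_le_self _ _) _

/-- Averaging over all permutations: the number of permutations mapping a fixed `s`-set into a set
of size `x`. -/
theorem card_perm_maps_into_mul_choose {α : Type*} [Fintype α] [DecidableEq α] (X T : Finset α) :
    (Finset.univ.filter fun π : Equiv.Perm α => ∀ v ∈ T, π v ∈ X).card *
      (Fintype.card α).choose T.card = (Fintype.card α).factorial * X.card.choose T.card := by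
  classical
  -- The count depends only on the size of the set: precompose with a permutation `τ` carrying `T'`
  -- to `T`. Then count pairs (T', π) in two ways.
  have hT : ∀ T' ∈ (Finset.univ : Finset α).powersetCard T.card,
      (Finset.univ.filter fun π : Equiv.Perm α => ∀ v ∈ T', π v ∈ X).card =
      (Finset.univ.filter fun π : Equiv.Perm α => ∀ v ∈ T, π v ∈ X).card := by
    intro T' hT'
    have hc := (Finset.mem_powersetCard.1 hT').2
    let e0 : {v // v ∈ T'} ≃ {v // v ∈ T} := Fintype.equivOfCardEq (by simpa using hc)
    let τ : Equiv.Perm α := e0.extendSubtype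
    have hτ : ∀ v, v ∈ T' ↔ τ v ∈ T := by
      intro v
      by_cases hv : v ∈ T'
      · exact ⟨fun _ => e0.extendSubtype_mem v hv, fun _ => hv⟩
      · exact ⟨fun h => absurd h hv, fun h => absurd h (e0.extendSubtype_not_mem v hv)⟩
    refine Finset.card_bij' (fun π _ => τ.symm.trans π) (fun π _ => τ.trans π) ?_ ?_ ?_ ?_
    · intro π hπ
      simp only [Finset.mem_filter, Finset.mem_univ, true_and] at hπ ⊢
      intro v hv
      exact hπ _ ((hτ _).2 (by simpa using hv))
    · intro π hπ
      simp only [Finset.mem_filter, Finset.mem_univ, true_and] at hπ ⊢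
      intro v hv
      exact hπ _ ((hτ _).1 hv)
    · intro π _; ext v; simp
    · intro π _; ext v; simp
  have h1 : ∑ T' ∈ (Finset.univ : Finset α).powersetCard T.card,
      (Finset.univ.filter fun π : Equiv.Perm α => ∀ v ∈ T', π v ∈ X).card =
      ∑ π : Equiv.Perm α,
        (((Finset.univ : Finset α).powersetCard T.card).filter fun T' => ∀ v ∈ T', π v ∈ X).card :=
    by simp only [Finset.card_filter]; exact Finset.sum_comm
  rw [Finset.sum_congr rfl hT, Finset.sum_const, Finset.card_powersetCard, Finset.card_univ,
    smul_eq_mul, mul_comm] at h1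
  rw [h1, ← Fintype.card_perm, ← smul_eq_mul, ← Finset.card_univ, ← Finset.sum_const]
  refine Finset.sum_congr rfl fun π _ => ?_
  have hX : X.card = (X.map π.symm.toEmbedding).card := (Finset.card_map _).symm
  rw [hX, ← Finset.card_powersetCard]
  congr 1
  ext T'
  simp only [Finset.mem_filter, Finset.mem_powersetCard, Finset.subset_univ, true_and,
    Finset.subset_iff (s₂ := X.map _), Finset.mem_map_equiv, Equiv.symm_symm]
  exact and_comm

/-! ### Balanced colourings of the edges between two sets. -/

/-- The capacities of the colour classes at a vertex: the first two colours, taken in the order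
given by `β`, share `a'` edges equally, and every further colour `i` gets `s i - 1` edges. -/
def colourCapacity {k : ℕ} (S : Fin k → ℕ) (a : ℕ) (β : Bool) : Fin (k + 2) → ℕ :=
  Matrix.vecCons (if β then aPrime S a / 2 else (aPrime S a + 1) / 2)
    (Matrix.vecCons (if β then (aPrime S a + 1) / 2 else aPrime S a / 2) fun i => S i - 1)

theorem le_sum_colourCapacity {k : ℕ} (S : Fin k → ℕ) (a : ℕ) (β : Bool) :
    a ≤ ∑ i, colourCapacity S a β i := by
  simp only [colourCapacity, Fin.sum_univ_succ, Matrix.cons_val_zero, Matrix.cons_val_succ]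
  unfold aPrime
  cases β <;> simp <;> omega

/-- Summing over both orders symmetrises the floor and ceiling halves, so colours 0 and 1 have the
same average. -/
theorem sum_choose_colourCapacity {k : ℕ} (s : ℕ) (S : Fin k → ℕ) (a : ℕ) {c : Fin (k + 2)}
    (hc : c = 0 ∨ c = 1) :
    ∑ β : Bool, (colourCapacity S a β c).choose s = balancedChoose s (aPrime S a) := by
  rcases hc with rfl | rfl <;> simp [colourCapacity, balancedChoose, add_comm]

/-- The vertices of `B` can colour their edges to `A` such that few edges at each vertex get the
colours `≥ 2`, while the number of vertices of `B` joined to a given `s`-set by edges of colour `0`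
(or `1`) is about the average over all balanced colourings. -/
theorem exists_balanced_colouring {V : Type*} [DecidableEq V] {k : ℕ} (s : ℕ) (S : Fin k → ℕ)
    (A B : Finset V) :
    ∃ χ : V → V → Fin (k + 2),
      (∀ b, ∀ i : Fin k, (A.filter fun v => χ b v = i.succ.succ).card ≤ S i - 1) ∧
      ∀ T ⊆ A, T.card = s → ∀ c : Fin (k + 2), c = 0 ∨ c = 1 →
        (B.filter fun b => ∀ v ∈ T, χ b v = c).card * (2 * A.card.choose s) ≤
          balancedChoose s (aPrime S A.card) * (B.card + 2 * A.card.factorial) := by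
  classical
  have hp : ∀ β : Bool, ∃ p : A → Fin (k + 2), ∀ i,
      (Finset.univ.filter fun v => p v = i).card ≤ colourCapacity S A.card β i := fun β =>
    exists_map_card_fiber_le _ (by simpa using le_sum_colourCapacity S A.card β)
  choose p hp using hp
  -- Each vertex of `B` receives an order of the two main colours and a permutation of `A` to apply
  -- to the fixed pattern `p`, all choices being used almost equally often.
  obtain ⟨φ, hφ⟩ := exists_equidistributed_map (Ω := Bool × Equiv.Perm A) B
  have hM : Fintype.card (Bool × Equiv.Perm A) = 2 * A.card.factorial := by
    simp [Fintype.card_perm]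
  rw [hM] at hφ
  refine ⟨fun b v => if h : v ∈ A then p (φ b).1 ((φ b).2 ⟨v, h⟩) else 0, fun b i => ?_,
    fun T hTA hT c hc => ?_⟩
  · refine le_trans ?_ ((hp (φ b).1 i.succ.succ).trans_eq (by simp [colourCapacity]))
    rw [← Finset.card_map (f := (φ b).2.symm.toEmbedding.trans (Function.Embedding.subtype _))]
    refine Finset.card_le_card fun v hv => ?_
    obtain ⟨hv, h⟩ := Finset.mem_filter.1 hv
    simp only [dif_pos hv] at h
    simp only [Finset.mem_map, Finset.mem_filter, Finset.mem_univ, true_and]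
    exact ⟨(φ b).2 ⟨v, hv⟩, h, by simp⟩
  · set T' : Finset A := T.subtype (· ∈ A) with hT'
    have hT'c : T'.card = s := by
      rw [hT', Finset.card_subtype, Finset.filter_true_of_mem fun v hv => hTA hv, hT]
    set Good : Finset (Bool × Equiv.Perm A) :=
      Finset.univ.filter fun ω => ∀ v ∈ T', p ω.1 (ω.2 v) = c with hGood
    have hgood : Good.card * A.card.choose s ≤
        A.card.factorial * balancedChoose s (aPrime S A.card) := by
      have h1 : Good.card = ∑ β : Bool, (Finset.univ.filter fun π : Equiv.Perm A =>
          ∀ v ∈ T', π v ∈ Finset.univ.filter fun w => p β w = c).card := by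
        rw [hGood, Finset.card_filter, Fintype.sum_prod_type]
        simp only [Finset.card_filter, Finset.mem_filter, Finset.mem_univ, true_and]
      rw [h1, Finset.sum_mul, ← sum_choose_colourCapacity s S A.card hc, Finset.mul_sum]
      refine Finset.sum_le_sum fun β _ => ?_
      have h2 := card_perm_maps_into_mul_choose (Finset.univ.filter fun w => p β w = c) T'
      rw [hT'c, Fintype.card_coe] at h2
      rw [h2]
      exact Nat.mul_le_mul_left _ (Nat.choose_le_choose s (hp β c))
    set X := B.filter fun b => ∀ v ∈ T,
      (if h : v ∈ A then p (φ b).1 ((φ b).2 ⟨v, h⟩) else 0) = c with hX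
    have hXc : X.card * (2 * A.card.factorial) ≤
        Good.card * (B.card + 2 * A.card.factorial) := by
      have hmap : ∀ b ∈ X, φ b ∈ Good := by
        intro b hb
        refine Finset.mem_filter.2 ⟨Finset.mem_univ _, fun v hv => ?_⟩
        have h := (Finset.mem_filter.1 hb).2 v (Finset.mem_subtype.1 hv)
        rwa [dif_pos v.2] at h
      rw [Finset.card_eq_sum_card_fiberwise hmap, Finset.sum_mul,
        ← Finset.sum_const_nat fun _ _ => rfl]
      refine Finset.sum_le_sum fun ω _ => le_trans (Nat.mul_le_mul_right _ ?_) (hφ ω)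
      exact Finset.card_le_card (Finset.filter_subset_filter _ (Finset.filter_subset _ _))
    refine Nat.le_of_mul_le_mul_left ?_ A.card.factorial_pos
    calc A.card.factorial * (X.card * (2 * A.card.choose s))
        = X.card * (2 * A.card.factorial) * A.card.choose s := by ring
      _ ≤ Good.card * (B.card + 2 * A.card.factorial) * A.card.choose s :=
          Nat.mul_le_mul_right _ hXc
      _ = Good.card * A.card.choose s * (B.card + 2 * A.card.factorial) := by ring
      _ ≤ A.card.factorial * balancedChoose s (aPrime S A.card) *
            (B.card + 2 * A.card.factorial) := Nat.mul_le_mul_right _ hgood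
      _ = _ := by ring

/-! ### Lower bound: colouring a graph with few edges. -/

theorem sum_card_neighbours_le_ncard_edgeSet {V : Type*} [Fintype V] [DecidableEq V]
    (G : SimpleGraph V) [DecidableRel G.Adj] (L : Finset V) :
    ∑ b ∈ Lᶜ, (L.filter fun v => G.Adj b v).card ≤ G.edgeSet.ncard := by
  rw [← SimpleGraph.coe_edgeFinset, Set.ncard_coe_finset, ← Finset.card_sigma]
  refine Finset.card_le_card_of_injOn (fun x => s(x.1, x.2)) ?_ ?_
  · rintro ⟨b, v⟩ h
    simp only [Finset.coe_sigma, Set.mem_sigma_iff, Finset.mem_coe, Finset.mem_filter] at h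
    simpa using h.2.2
  · rintro ⟨b, v⟩ h ⟨b', v'⟩ h' heq
    simp only [Finset.coe_sigma, Set.mem_sigma_iff, Finset.mem_coe, Finset.mem_filter,
      Finset.mem_compl] at h h'
    simp only [Sym2.eq_iff] at heq
    rcases heq with ⟨rfl, rfl⟩ | ⟨rfl, rfl⟩
    · rfl
    · exact absurd h'.2.1 h.1

/-- The balanced colouring is applied separately to each class of vertices outside `L` with the same
neighbourhood in `L`. The hypothesis `hm` turns the fraction 1/f(|A|) into |A|/m, so the main terms
add up to a number of edges of `G`. -/
theorem exists_colouring_between {V : Type*} [Fintype V] [DecidableEq V] (G : SimpleGraph V)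
    [DecidableRel G.Adj] (L : Finset V) {k : ℕ} (s : ℕ) (S : Fin k → ℕ) {m : ℝ} (hm0 : 0 ≤ m)
    (hm : ∀ a : ℕ, m * balancedChoose s (aPrime S a) ≤ a * (2 * a.choose s : ℕ)) :
    ∃ χ : V → V → Fin (k + 2),
      (∀ b, ∀ i : Fin k,
        (L.filter fun v => G.Adj b v ∧ χ b v = i.succ.succ).card ≤ S i - 1) ∧
      ∀ T ⊆ L, T.card = s → ∀ c : Fin (k + 2), c = 0 ∨ c = 1 →
        m * (Lᶜ.filter fun b => ∀ v ∈ T, G.Adj b v ∧ χ b v = c).card ≤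
          G.edgeSet.ncard +
            (2 ^ L.card * (L.card * (2 * L.card.factorial)) : ℕ) := by
  let nb : V → Finset V := fun b => L.filter fun v => G.Adj b v
  let B : Finset V → Finset V := fun A => Lᶜ.filter fun b => nb b = A
  choose χ hχ1 hχ2 using fun A : Finset V => exists_balanced_colouring (k := k) s S A (B A)
  refine ⟨fun b => χ (nb b) b, fun b i => ?_, fun T hTL hT c hc => ?_⟩
  · rw [← Finset.filter_filter]
    exact hχ1 (nb b) b i
  have hnb : ∀ b ∈ (Lᶜ : Finset V), nb b ∈ L.powerset := fun b _ =>
    Finset.mem_powerset.2 (Finset.filter_subset _ _)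
  set X := Lᶜ.filter fun b => ∀ v ∈ T, G.Adj b v ∧ χ (nb b) b v = c with hX
  have hXA : ∀ A ∈ L.powerset, m * ((X.filter fun b => nb b = A).card : ℝ) ≤
      (A.card * ((B A).card + 2 * A.card.factorial) : ℕ) := by
    intro A _
    -- A nonempty class forces `T ⊆ A`, so the binomial coefficient to be cancelled is positive.
    rcases (X.filter fun b => nb b = A).eq_empty_or_nonempty with h | ⟨b, hb⟩
    · rw [h, Finset.card_empty, Nat.cast_zero, mul_zero]
      exact Nat.cast_nonneg _
    have hTA : T ⊆ A := by
      intro v hv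
      obtain ⟨hbX, rfl⟩ := Finset.mem_filter.1 hb
      exact Finset.mem_filter.2 ⟨hTL hv, ((Finset.mem_filter.1 hbX).2 v hv).1⟩
    have hpos : (0 : ℝ) < (2 * A.card.choose s : ℕ) := by
      have := Nat.choose_pos (hT ▸ Finset.card_le_card hTA)
      exact_mod_cast (by omega)
    have h1 : ((B A).filter fun b => ∀ v ∈ T, χ A b v = c).card * (2 * A.card.choose s) ≤
        balancedChoose s (aPrime S A.card) * ((B A).card + 2 * A.card.factorial) := by
      convert hχ2 A T hTA hT c hc
    have h2 : (X.filter fun b => nb b = A).card ≤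
        ((B A).filter fun b => ∀ v ∈ T, χ A b v = c).card := by
      refine Finset.card_le_card fun b hb => ?_
      obtain ⟨hbX, rfl⟩ := Finset.mem_filter.1 hb
      obtain ⟨hbL, h⟩ := Finset.mem_filter.1 hbX
      exact Finset.mem_filter.2 ⟨Finset.mem_filter.2 ⟨hbL, rfl⟩, fun v hv => (h v hv).2⟩
    have h3 : (((X.filter fun b => nb b = A).card : ℝ)) * (2 * A.card.choose s : ℕ) ≤
        balancedChoose s (aPrime S A.card) * ((B A).card + 2 * A.card.factorial : ℕ) := by
      exact_mod_cast (Nat.mul_le_mul_right _ h2).trans h1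
    refine le_of_mul_le_mul_right ?_ hpos
    calc m * ((X.filter fun b => nb b = A).card : ℝ) * (2 * A.card.choose s : ℕ)
        ≤ m * (balancedChoose s (aPrime S A.card) *
            ((B A).card + 2 * A.card.factorial : ℕ)) := by
          rw [mul_assoc]
          exact mul_le_mul_of_nonneg_left h3 hm0
      _ = m * balancedChoose s (aPrime S A.card) *
            ((B A).card + 2 * A.card.factorial : ℕ) := by ring
      _ ≤ A.card * (2 * A.card.choose s : ℕ) * ((B A).card + 2 * A.card.factorial : ℕ) :=
          mul_le_mul_of_nonneg_right (hm _) (Nat.cast_nonneg _)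
      _ = _ := by push_cast; ring
  have hsum : m * (X.card : ℝ) ≤
      (∑ A ∈ L.powerset, A.card * ((B A).card + 2 * A.card.factorial) : ℕ) := by
    rw [Finset.card_eq_sum_card_fiberwise (f := nb) (t := L.powerset)
      fun b hb => hnb b (Finset.filter_subset _ _ hb)]
    push_cast [Finset.mul_sum]
    exact Finset.sum_le_sum fun A hA => by exact_mod_cast hXA A hA
  refine hsum.trans ?_
  rw [← Nat.cast_add]
  refine Nat.cast_le.2 ?_
  simp only [mul_add, Finset.sum_add_distrib]
  refine add_le_add ?_ ?_
  · refine le_trans (le_of_eq ?_) (sum_card_neighbours_le_ncard_edgeSet G L)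
    rw [← Finset.sum_fiberwise_of_maps_to hnb]
    refine Finset.sum_congr rfl fun A _ => ?_
    rw [mul_comm]
    exact (Finset.sum_const_nat fun b hb => by rw [← (Finset.mem_filter.1 hb).2]).symm
  -- Rounding costs a bounded amount for each of the `2 ^ L.card` possible neighbourhoods.
  · rw [← Finset.card_powerset, ← smul_eq_mul (a := Finset.card _), ← Finset.sum_const]
    refine Finset.sum_le_sum fun A hA => ?_
    have h := Finset.card_le_card (Finset.mem_powerset.1 hA)
    have := Nat.factorial_le h
    gcongr

theorem SimpleGraph.card_le_degree_of_isCompleteBetween {V : Type*} [Fintype V]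
    {G : SimpleGraph V} [DecidableRel G.Adj] {X Y : Finset V}
    (h : G.IsCompleteBetween X Y) {x : V} (hx : x ∈ X) : Y.card ≤ G.degree x := by
  rw [← G.card_neighborFinset_eq_degree]
  exact Finset.card_le_card fun y hy => (G.mem_neighborFinset x y).2 (h hx hy)

/-- A graph with few edges does not arrow `(K_{s,n}, K_{s,n}, K_{s₃,t₃}, …, K_{s_r,t_r})`. -/
theorem not_arrows_forbiddenTuple {V : Type} [Fintype V] [DecidableEq V] (G : SimpleGraph V)
    [DecidableRel G.Adj] (L : Finset V) {k s : ℕ} {S T : Fin k → ℕ} (hS : ∀ i, 1 ≤ S i)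
    (hST : ∀ i, S i ≤ T i) {m : ℝ} (hm0 : 0 ≤ m)
    (hm : ∀ a : ℕ, m * balancedChoose s (aPrime S a) ≤ a * (2 * a.choose s : ℕ)) {n : ℕ}
    (hL : ∀ v, n ≤ G.degree v → v ∈ L)
    (hn : m * L.card + G.edgeSet.ncard + (2 ^ L.card * (L.card * (2 * L.card.factorial)) : ℕ) <
      m * n) :
    ¬ Arrows G (forbiddenTuple s S T n) := by
  classical
  intro hG
  obtain ⟨χ, hχ1, hχ2⟩ := exists_colouring_between G L s S hm0 hm
  -- Edges inside `L` or inside its complement get colour 0. This is harmless: the s-side of a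
  -- K_{s,n} lies in `L`, and at most |L| vertices of its other side do.
  let col : V → V → Fin (k + 2) := fun x y =>
    if x ∈ L then if y ∈ L then 0 else χ y x else if y ∈ L then χ x y else 0
  have col_symm : ∀ x y, col y x = col x y := by
    intro x y
    by_cases hx : x ∈ L <;> by_cases hy : y ∈ L <;> simp [col, hx, hy]
  let c : G.EdgeLabeling (Fin (k + 2)) :=
    SimpleGraph.EdgeLabeling.mk (fun x y _ => col x y) fun x y _ => col_symm x y
  have hc : ∀ i x y, (c.labelGraph i).Adj x y ↔ G.Adj x y ∧ col x y = i := by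
    intro i x y
    rw [SimpleGraph.EdgeLabeling.labelGraph_adj]
    exact ⟨fun ⟨h, h'⟩ => ⟨h, h'⟩, fun ⟨h, h'⟩ => ⟨h, h'⟩⟩
  obtain ⟨i, hi⟩ := hG c
  simp only [forbiddenTuple, completeBipartiteTuple] at hi
  rw [SimpleGraph.completeBipartiteGraph_isContained_iff] at hi
  obtain ⟨X, Y, hX, hY, hXY⟩ := hi
  rw [Fintype.card_fin] at hX hY
  have main : ∀ j : Fin (k + 2), j = 0 ∨ j = 1 → X.card = s → Y.card = n →
      (c.labelGraph j).IsCompleteBetween X Y → False := by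
    intro j hj hX hY hXY
    have hXL : X ⊆ L := by
      intro x hx
      refine hL x (hY ▸ SimpleGraph.card_le_degree_of_isCompleteBetween (X := X) ?_ hx)
      exact fun x hx y hy => ((hc j x y).1 (hXY hx hy)).1
    have h1 := hχ2 X hXL hX j hj
    have h2 : Y.card ≤ L.card +
        (Lᶜ.filter fun b => ∀ v ∈ X, G.Adj b v ∧ χ b v = j).card := by
      refine le_trans (Finset.card_le_card fun y hy => ?_) (Finset.card_union_le _ _)
      by_cases hyL : y ∈ L
      · exact Finset.mem_union_left _ hyL
      · refine Finset.mem_union_right _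
          (Finset.mem_filter.2 ⟨Finset.mem_compl.2 hyL, fun x hx => ?_⟩)
        have h := (hc j x y).1 (hXY hx hy)
        refine ⟨h.1.symm, ?_⟩
        simpa [col, hXL hx, hyL] using h.2
    have h3 : m * n ≤ m * (L.card +
        (Lᶜ.filter fun b => ∀ v ∈ X, G.Adj b v ∧ χ b v = j).card : ℕ) := by
      rw [← hY]
      exact mul_le_mul_of_nonneg_left (Nat.cast_le.2 h2) hm0
    rw [Nat.cast_add, mul_add] at h3
    linarith
  -- Edges of a later colour only run between `L` and its complement, and a vertex outside `L` has
  -- fewer than `S i` of them.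
  have main' : ∀ i : Fin k, ∀ Y : Finset V, S i ≤ Y.card → ∀ x ∉ L,
      (∀ y ∈ Y, (c.labelGraph i.succ.succ).Adj x y) → False := by
    intro i Y hY x hx h
    have h1 := hχ1 x i
    have h2 : Y ⊆ L.filter fun v => G.Adj x v ∧ χ x v = i.succ.succ := by
      intro y hy
      obtain ⟨h3, h4⟩ := (hc _ x y).1 (h y hy)
      have hyL : y ∈ L := by
        by_contra hyL
        simp only [col, hx, hyL, if_false] at h4
        exact (Fin.succ_ne_zero _ h4.symm).elim
      refine Finset.mem_filter.2 ⟨hyL, h3, ?_⟩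
      simpa [col, hx, hyL] using h4
    have h3 := Finset.card_le_card h2
    have := hS i
    omega
  refine Fin.cases (fun hX hY hXY => ?_) (fun i => Fin.cases (fun hX hY hXY => ?_)
    (fun i hX hY hXY => ?_) i) i hX hY hXY
  · exact main 0 (Or.inl rfl) hX hY hXY
  · exact main 1 (Or.inr rfl) hX hY hXY
  · simp only [Matrix.cons_val_succ] at hX hY
    obtain ⟨x, hx⟩ : X.Nonempty := Finset.card_pos.1 (by have := hS i; omega)
    obtain ⟨y, hy⟩ : Y.Nonempty := Finset.card_pos.1 (by have := hS i; have := hST i; omega)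
    by_cases hxL : x ∈ L
    · have hyL : y ∉ L := by
        intro hyL
        have h := ((hc _ x y).1 (hXY hx hy)).2
        simp only [col, hxL, hyL, if_true] at h
        exact Fin.succ_ne_zero _ h.symm
      exact main' i X hX.ge y hyL fun z hz => (hXY hz hy).symm
    · exact main' i Y (by have := hST i; omega) x hxL fun z hz => hXY hx hz

/-! ### Upper bound: unbalanced complete bipartite graphs. -/

theorem Arrows.ncard_mem_arrowingSizes {V ι : Type} [Finite V] {W : ι → Type}
    {G : SimpleGraph V} {F : (i : ι) → SimpleGraph (W i)} (h : Arrows G F) :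
    G.edgeSet.ncard ∈ arrowingSizes F := by
  cases nonempty_fintype V
  let e : V ≃ Fin (Fintype.card V) := Fintype.equivFin V
  let φ : G ≃g G.map e := SimpleGraph.Iso.map e G
  refine ⟨_, G.map e, fun c => ?_, (Nat.card_congr φ.mapEdgeSet).symm⟩
  obtain ⟨i, hi⟩ := h (c.pullback φ.toEmbedding.toHom)
  refine ⟨i, hi.trans (SimpleGraph.isContained_iff_exists_le_comap.2
    ⟨e.toEmbedding, fun x y hxy => ?_⟩)⟩
  obtain ⟨H, hc⟩ := (SimpleGraph.EdgeLabeling.labelGraph_adj x y).1 hxy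
  exact (SimpleGraph.EdgeLabeling.labelGraph_adj _ _).2 ⟨φ.map_adj_iff.2 H, hc⟩

theorem ncard_edgeSet_completeBipartiteGraph (a b : ℕ) :
    (completeBipartiteGraph (Fin a) (Fin b)).edgeSet.ncard = a * b := by
  rw [Set.ncard_def, SimpleGraph.encard_edgeSet_completeBipartiteGraph]
  simp

/-- Double counting of pairs (U, b) with U a p-set joined to b entirely in colour `j`. -/
theorem sum_choose_card_fiber_le {α β ι : Type*} [Fintype α] [Fintype β] [DecidableEq ι]
    (f : α → β → ι) (j : ι) (p q : ℕ)
    (h : ∀ U : Finset α, U.card = p → (Finset.univ.filter fun b => ∀ u ∈ U, f u b = j).card ≤ q) :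
    ∑ b, (Finset.univ.filter fun u => f u b = j).card.choose p ≤
      (Fintype.card α).choose p * q := by
  have h1 : ∀ b, (Finset.univ.filter fun u => f u b = j).card.choose p =
      (((Finset.univ : Finset α).powersetCard p).filter fun U => ∀ u ∈ U, f u b = j).card := by
    intro b
    rw [← Finset.card_powersetCard]
    congr 1
    ext U
    simp only [Finset.mem_powersetCard, Finset.mem_filter, Finset.subset_iff, Finset.mem_univ,
      true_and, implies_true]
    exact and_comm
  simp only [h1]
  simp only [Finset.card_filter]
  rw [Finset.sum_comm, ← Finset.card_univ, ← Finset.card_powersetCard, ← smul_eq_mul,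
    ← Finset.sum_const]
  refine Finset.sum_le_sum fun U hU => ?_
  rw [← Finset.card_filter]
  exact h U (Finset.mem_powersetCard.1 hU).2

/-- A sufficiently unbalanced complete bipartite graph arrows
`(K_{s,n}, K_{s,n}, K_{s₃,t₃}, …, K_{s_r,t_r})`. -/
theorem arrows_completeBipartiteGraph {k s n a N : ℕ} {S T : Fin k → ℕ}
    (h : (∑ i, a.choose (S i) * T i) * balancedChoose s (aPrime S a) + 2 * a.choose s * n <
      N * balancedChoose s (aPrime S a)) :
    Arrows (completeBipartiteGraph (Fin a) (Fin N)) (forbiddenTuple s S T n) := by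
  classical
  intro c
  by_contra hex
  have hno := not_exists.1 hex
  have hadj : ∀ u b, (completeBipartiteGraph (Fin a) (Fin N)).Adj (Sum.inl u) (Sum.inr b) :=
    fun u b => by simp
  let col : Fin a → Fin N → Fin (k + 2) := fun u b => c.get (Sum.inl u) (Sum.inr b) (hadj u b)
  let d : Fin (k + 2) → Fin N → ℕ := fun j b => (Finset.univ.filter fun u => col u b = j).card
  have key : ∀ j p q, ¬ (completeBipartiteGraph (Fin p) (Fin q)).IsContained (c.labelGraph j) →
      ∑ b, (d j b).choose p ≤ a.choose p * q := by
    intro j p q hfree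
    suffices h : ∀ U : Finset (Fin a), U.card = p →
        (Finset.univ.filter fun b => ∀ u ∈ U, col u b = j).card ≤ q by
      simpa only [Fintype.card_fin] using
        sum_choose_card_fiber_le col j p q fun U hU => by convert h U hU
    intro U hU
    by_contra! hlt
    obtain ⟨W, hW, hWq⟩ := Finset.exists_subset_card_eq hlt.le
    have hUW : ∀ u ∈ U, ∀ b ∈ W, col u b = j := fun u hu b hb =>
      (Finset.mem_filter_univ b).1 (hW hb) u hu
    refine hfree (SimpleGraph.completeBipartiteGraph_isContained_iff.2
      ⟨U.map Function.Embedding.inl, W.map Function.Embedding.inr, by simpa using hU,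
        by simpa using hWq, ?_⟩)
    intro x hx y hy
    obtain ⟨u, hu, rfl⟩ := Finset.mem_map.1 (Finset.mem_coe.1 hx)
    obtain ⟨b, hb, rfl⟩ := Finset.mem_map.1 (Finset.mem_coe.1 hy)
    exact (SimpleGraph.EdgeLabeling.labelGraph_adj _ _).2
      ⟨hadj u b, hUW u hu b hb⟩
  have h0 := key 0 s n (hno 0)
  have h1 := key 1 s n (hno 1)
  have h2 : ∀ i : Fin k, ∑ b, (d i.succ.succ b).choose (S i) ≤ a.choose (S i) * T i :=
    fun i => key i.succ.succ (S i) (T i) (hno i.succ.succ)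
  -- The last summand absorbs the exceptional vertices, those with at least `S i` edges of some
  -- later colour; at the others colours 0 and 1 share at least a' edges.
  have hpt : ∀ b, balancedChoose s (aPrime S a) ≤ (d 0 b).choose s + (d 1 b).choose s +
      (∑ i, (d (Fin.succ (Fin.succ i)) b).choose (S i)) * balancedChoose s (aPrime S a) := by
    intro b
    by_cases hb : ∃ i, S i ≤ d (Fin.succ (Fin.succ i)) b
    · obtain ⟨i, hi⟩ := hb
      have : 1 ≤ ∑ i, (d (Fin.succ (Fin.succ i)) b).choose (S i) :=
        (Nat.choose_pos hi).trans_le (Finset.single_le_sum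
          (f := fun i => (d (Fin.succ (Fin.succ i)) b).choose (S i))
          (fun _ _ => Nat.zero_le _) (Finset.mem_univ i))
      exact (Nat.le_mul_of_pos_left _ this).trans (Nat.le_add_left _ _)
    · push Not at hb
      refine (balancedChoose_le s ?_).trans (Nat.le_add_right _ _)
      have hsum : ∑ j, d j b = a := by
        have := Finset.card_eq_sum_card_fiberwise (s := (Finset.univ : Finset (Fin a)))
          (t := Finset.univ) (f := fun u => col u b) fun _ _ => Finset.mem_univ _
        rw [Finset.card_univ, Fintype.card_fin] at this
        exact this.symm
      rw [Fin.sum_univ_succ, Fin.sum_univ_succ] at hsum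
      have hle : ∑ i : Fin k, d i.succ.succ b ≤ ∑ i, (S i - 1) :=
        Finset.sum_le_sum fun i _ => Nat.le_sub_one_of_lt (hb i)
      have h01 : d (Fin.succ 0) b = d 1 b := rfl
      unfold aPrime
      omega
  have htot := Finset.sum_le_sum fun b (_ : b ∈ (Finset.univ : Finset (Fin N))) => hpt b
  rw [Finset.sum_const, Finset.card_univ, Fintype.card_fin, smul_eq_mul, Finset.sum_add_distrib,
    Finset.sum_add_distrib, ← Finset.sum_mul, Finset.sum_comm] at htot
  have h3 := Nat.mul_le_mul_right (balancedChoose s (aPrime S a))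
    (Finset.sum_le_sum fun i (_ : i ∈ (Finset.univ : Finset (Fin k))) => h2 i)
  have h4 : 2 * a.choose s * n = a.choose s * n + a.choose s * n := by ring
  omega

/-! ### The minimisation over a, and the two bounds with explicit constants. -/

/-- Since σ = 2s - 2 + ∑ (s_i - 1), the range a > σ is exactly where the denominator of f is
positive. -/
theorem sigma_lt_iff {k s : ℕ} (hs : 1 ≤ s) {S : Fin k → ℕ} (hS : ∀ i, 1 ≤ S i) (a : ℕ) :
    sigma s S < a ↔ 2 * s - 1 ≤ aPrime S a := by
  have h : ∑ i, (S i - 1) + k = ∑ i, S i := by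
    have : ∑ i, (S i - 1 + 1) = ∑ i, S i :=
      Finset.sum_congr rfl fun i _ => Nat.sub_add_cancel (hS i)
    simpa [Finset.sum_add_distrib] using this
  unfold sigma aPrime
  rw [← Nat.cast_sum]
  omega

theorem balancedChoose_pos_iff {s : ℕ} (n : ℕ) :
    0 < balancedChoose s n ↔ 2 * s - 1 ≤ n := by
  constructor
  · intro h
    by_contra! hn
    rw [balancedChoose, Nat.choose_eq_zero_of_lt (by omega),
      Nat.choose_eq_zero_of_lt (by omega)] at h
    exact h.false
  · intro h
    exact Nat.add_pos_right _ (Nat.choose_pos (by omega))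

theorem fRatio_eq {k : ℕ} (s : ℕ) (S : Fin k → ℕ) (a : ℕ) :
    fRatio s S a = 2 * (a.choose s : ℝ) / (balancedChoose s (aPrime S a) : ℝ) := by
  rw [fRatio, balancedChoose, Nat.cast_add]

theorem one_le_fRatio {k s : ℕ} (hs : 1 ≤ s) {S : Fin k → ℕ} (hS : ∀ i, 1 ≤ S i) {a : ℕ}
    (ha : sigma s S < a) : 1 ≤ fRatio s S a := by
  have hg := (balancedChoose_pos_iff _).2 ((sigma_lt_iff hs hS a).1 ha)
  rw [sigma_lt_iff hs hS] at ha
  rw [fRatio_eq, one_le_div (by exact_mod_cast hg)]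
  have h : aPrime S a ≤ a := Nat.sub_le _ _
  have h1 := Nat.choose_le_choose s (show aPrime S a / 2 ≤ a by omega)
  have h2 := Nat.choose_le_choose s (show (aPrime S a + 1) / 2 ≤ a by omega)
  have : balancedChoose s (aPrime S a) ≤ 2 * a.choose s := by
    unfold balancedChoose
    omega
  exact_mod_cast this

/-- Since f ≥ 1, a·f(a) ≥ a, so only finitely many a can beat a given value. -/
theorem exists_isLeast_mul_fRatio {k s : ℕ} (hs : 1 ≤ s) {S : Fin k → ℕ} (hS : ∀ i, 1 ≤ S i) :
    ∃ a : ℕ, sigma s S < a ∧ ∀ b : ℕ, sigma s S < b → a * fRatio s S a ≤ b * fRatio s S b := by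
  classical
  have hlt : sigma s S < ((sigma s S).toNat + 1 : ℕ) := by omega
  set a₀ := (sigma s S).toNat + 1
  let I := (Finset.range (⌈a₀ * fRatio s S a₀⌉₊ + a₀ + 1)).filter fun a : ℕ => sigma s S < a
  have ha₀ : a₀ ∈ I := Finset.mem_filter.2 ⟨Finset.mem_range.2 (by omega), hlt⟩
  obtain ⟨a, ha, hmin⟩ := I.exists_min_image (fun a : ℕ => (a : ℝ) * fRatio s S a) ⟨a₀, ha₀⟩
  refine ⟨a, (Finset.mem_filter.1 ha).2, fun b hb => ?_⟩
  by_cases hbI : b ∈ I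
  · exact hmin b hbI
  · have h1 : ⌈a₀ * fRatio s S a₀⌉₊ ≤ b := by
      by_contra! h
      exact hbI (Finset.mem_filter.2 ⟨Finset.mem_range.2 (by omega), hb⟩)
    calc (a : ℝ) * fRatio s S a ≤ a₀ * fRatio s S a₀ := hmin a₀ ha₀
      _ ≤ b := Nat.ceil_le.1 h1
      _ ≤ b * fRatio s S b := le_mul_of_one_le_right (Nat.cast_nonneg _) (one_le_fRatio hs hS hb)

theorem exists_mem_arrowingSizes_le {k s : ℕ} (hs : 1 ≤ s) {S : Fin k → ℕ} (hS : ∀ i, 1 ≤ S i)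
    (T : Fin k → ℕ) {a : ℕ} (ha : sigma s S < a) (n : ℕ) :
    ∃ e ∈ arrowingSizes (forbiddenTuple s S T n),
      (e : ℝ) ≤ n * (a * fRatio s S a) + a * ((∑ i, a.choose (S i) * T i : ℕ) + 1) := by
  set K := ∑ i, a.choose (S i) * T i with hK
  -- `K` bounds the loss from exceptional vertices; the final 1 makes the pigeonhole inequality
  -- strict.
  set N := K + ⌊n * fRatio s S a⌋₊ + 1 with hN
  have hf : 0 ≤ n * fRatio s S a :=
    mul_nonneg (Nat.cast_nonneg _) (zero_le_one.trans (one_le_fRatio hs hS ha))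
  have hg : (0 : ℝ) < balancedChoose s (aPrime S a) := by
    exact_mod_cast (balancedChoose_pos_iff _).2 ((sigma_lt_iff hs hS a).1 ha)
  have harr : Arrows (completeBipartiteGraph (Fin a) (Fin N)) (forbiddenTuple s S T n) := by
    apply arrows_completeBipartiteGraph
    rw [← Nat.cast_lt (α := ℝ)]
    have h1 := Nat.lt_floor_add_one (n * fRatio s S a)
    have h2 := mul_lt_mul_of_pos_right h1 hg
    have h3 : n * fRatio s S a * balancedChoose s (aPrime S a) = 2 * a.choose s * n := by
      rw [fRatio_eq]
      field_simp
    rw [h3] at h2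
    rw [← hK, hN]
    push_cast
    linarith
  refine ⟨_, harr.ncard_mem_arrowingSizes, ?_⟩
  rw [ncard_edgeSet_completeBipartiteGraph, hN]
  push_cast
  have := mul_le_mul_of_nonneg_left (Nat.floor_le hf) (Nat.cast_nonneg (α := ℝ) a)
  linarith

theorem le_ncard_edgeSet_of_arrows {V : Type} [Fintype V] {G : SimpleGraph V} {k s : ℕ}
    {S T : Fin k → ℕ} (hS : ∀ i, 1 ≤ S i) (hST : ∀ i, S i ≤ T i) {m : ℝ} (hm0 : 0 ≤ m)
    (hm : ∀ a : ℕ, m * balancedChoose s (aPrime S a) ≤ a * (2 * a.choose s : ℕ)) {n : ℕ}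
    (hn : 1 ≤ n) (hG : Arrows G (forbiddenTuple s S T n)) :
    n * m - (m * ⌊2 * m⌋₊ +
      (2 ^ ⌊2 * m⌋₊ * (⌊2 * m⌋₊ * (2 * ⌊2 * m⌋₊.factorial)) : ℕ)) ≤ G.edgeSet.ncard := by
  classical
  by_contra! hlt
  let L : Finset V := Finset.univ.filter fun v => n ≤ G.degree v
  have hE : G.edgeSet.ncard = G.edgeFinset.card := by
    rw [← SimpleGraph.coe_edgeFinset, Set.ncard_coe_finset]
  have hL1 : n * L.card ≤ 2 * G.edgeSet.ncard := by
    rw [hE, ← G.sum_degrees_eq_twice_card_edges, mul_comm, ← smul_eq_mul, ← Finset.sum_const]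
    exact (Finset.sum_le_sum fun v hv => (Finset.mem_filter.1 hv).2).trans
      (Finset.sum_le_sum_of_subset (Finset.subset_univ _))
  -- Degree counting gives n|L| ≤ 2e(G) ≤ 2nm, so the error terms are bounded independently of n.
  have hL2 : L.card ≤ ⌊2 * m⌋₊ := by
    refine Nat.le_floor ?_
    have h1 : (n : ℝ) * L.card ≤ 2 * G.edgeSet.ncard := by exact_mod_cast hL1
    have h2 : (G.edgeSet.ncard : ℝ) ≤ n * m := hlt.le.trans (sub_le_self _ (by positivity))
    have hn0 : (0 : ℝ) < n := by exact_mod_cast hn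
    refine le_of_mul_le_mul_left ?_ hn0
    linarith
  refine not_arrows_forbiddenTuple G L hS hST hm0 hm
    (fun v hv => Finset.mem_filter.2 ⟨Finset.mem_univ _, hv⟩) ?_ hG
  have h1 : m * L.card ≤ m * ⌊2 * m⌋₊ := mul_le_mul_of_nonneg_left (Nat.cast_le.2 hL2) hm0
  have h2 : 2 ^ L.card * (L.card * (2 * L.card.factorial)) ≤
      2 ^ ⌊2 * m⌋₊ * (⌊2 * m⌋₊ * (2 * ⌊2 * m⌋₊.factorial)) := by
    have := Nat.factorial_le hL2
    gcongr
    norm_num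
  have h3 := (Nat.cast_le (α := ℝ)).2 h2
  linarith

theorem mainTheorem6 (k s : ℕ) (hs : 1 ≤ s) (S T : Fin k → ℕ)
    (hS : ∀ i, 1 ≤ S i) (hST : ∀ i, S i ≤ T i) :
    ∃ m : ℝ,
      IsLeast {x : ℝ | ∃ a : ℕ, sigma s S < (a : ℤ) ∧ x = (a : ℝ) * fRatio s S a} m ∧
      ∃ C : ℝ, ∀ n : ℕ, 1 ≤ n →
        (arrowingSizes (forbiddenTuple s S T n)).Nonempty ∧
        |(sizeRamsey (forbiddenTuple s S T n) : ℝ) - (n : ℝ) * m| ≤ C := by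
  obtain ⟨a, ha, hmin⟩ := exists_isLeast_mul_fRatio hs hS
  set m : ℝ := a * fRatio s S a with hmdef
  have hm0 : 0 ≤ m :=
    mul_nonneg (Nat.cast_nonneg _) (zero_le_one.trans (one_le_fRatio hs hS ha))
  -- Minimality of `m` with the denominator cleared; outside the admissible range the left side
  -- vanishes.
  have hm : ∀ b : ℕ, m * balancedChoose s (aPrime S b) ≤ b * (2 * b.choose s : ℕ) := by
    intro b
    rcases (balancedChoose s (aPrime S b)).eq_zero_or_pos with hb | hb
    · rw [hb, Nat.cast_zero, mul_zero]
      positivity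
    · have hb' := (sigma_lt_iff hs hS b).2 ((balancedChoose_pos_iff _).1 hb)
      have hg : (0 : ℝ) < balancedChoose s (aPrime S b) := by exact_mod_cast hb
      have h := hmin b hb'
      rw [fRatio_eq, ← mul_div_assoc, le_div_iff₀ hg] at h
      exact_mod_cast h
  refine ⟨m, ⟨⟨a, ha, rfl⟩, ?_⟩, max (a * ((∑ i, a.choose (S i) * T i : ℕ) + 1))
    (m * ⌊2 * m⌋₊ + (2 ^ ⌊2 * m⌋₊ * (⌊2 * m⌋₊ * (2 * ⌊2 * m⌋₊.factorial)) : ℕ)),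
    fun n hn => ?_⟩
  · rintro _ ⟨b, hb, rfl⟩
    exact hmin b hb
  obtain ⟨e, he, hle⟩ := exists_mem_arrowingSizes_le hs hS T ha n
  refine ⟨⟨e, he⟩, abs_le.2 ⟨?_, ?_⟩⟩
  · obtain ⟨N, G, hG, hGe⟩ := Nat.sInf_mem ⟨e, he⟩
    have h := le_ncard_edgeSet_of_arrows hS hST hm0 hm hn hG
    rw [hGe] at h
    have h' := le_max_right (a * ((∑ i, a.choose (S i) * T i : ℕ) + 1) : ℝ)
      (m * ⌊2 * m⌋₊ + (2 ^ ⌊2 * m⌋₊ * (⌊2 * m⌋₊ * (2 * ⌊2 * m⌋₊.factorial)) : ℕ))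
    unfold sizeRamsey
    linarith
  · have h : (sizeRamsey (forbiddenTuple s S T n) : ℝ) ≤ e := Nat.cast_le.2 (Nat.sInf_le he)
    refine le_trans ?_ (le_max_left _ _)
    linarith
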